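/- For $0<a<1$ let $s_a$ be the Sibuya distribution, i.e. the probability distribution on $\{1,2,\dots\}$ with generating function $\sum_{n\ge 1}s_a(n)z^n=1-(1-z)^a$, equivalently $s_a(n)=\frac{1}{n!}\,a(1-a)(2-a)\cdots(n-1-a)$ for $n\ge 1$. A probability distribution $q$ on $\{0,1,2,\dots\}$ is called a progeny if there is a probability distribution $p$ on $\{0,1,2,\dots\}$ with mean $\sum_n n\,p_n\le 1$ and a Galton–Watson process $Z_0=1$, $Z_{n+1}=\sum_{k=1}^{Z_n}X_{n,k}$, with $(X_{n,k})$ independent random variables of distribution $p$, such that the total progeny $\sum_{n\ge 0}Z_n$ has distribution $q$. (i) For every $0<a<1$, the distribution $s_a$ is a progeny if and only if $\tfrac12\le a<1$. (ii) For every $0<a<1$, with $b=1/a$, the distribution $s_a$ is a progeny if and only if the function $u\mapsto \dfrac{u}{1-(1-u)^b}$ has, near $u=0$, a power series expansion in $u$ with nonnegative coefficients. (iii) For every real $b\ne 0$, the function $u\mapsto \dfrac{u}{1-(1-u)^b}$ has, near $u=0$, a power series expansion in $u$ with nonnegative coefficients if and only if $1\le b\le 2$. -/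

import Mathlib

open MeasureTheory ProbabilityTheory Filter Topology
open scoped ENNReal

noncomputable section

/-! ### The Sibuya distribution -/

/-- The weight `s_a(n) = a (1 - a) (2 - a) ⋯ (n - 1 - a) / n!` for `n ≥ 1`, and `s_a(0) = 0`. -/
def sibuyaWeight (a : ℝ) : ℕ → ℝ
  | 0 => 0
  | n + 1 => a * (∏ k ∈ Finset.range n, ((k : ℝ) + 1 - a)) / ((n + 1).factorial : ℝ)

theorem sibuyaWeight_nonneg {a : ℝ} (h0 : 0 < a) (h1 : a < 1) (n : ℕ) : 0 ≤ sibuyaWeight a n := by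
  cases n with
  | zero => simp [sibuyaWeight]
  | succ n =>
    refine div_nonneg (mul_nonneg h0.le (Finset.prod_nonneg fun k _ => ?_)) (by positivity)
    have : (0 : ℝ) ≤ k := by positivity
    linarith

theorem sum_sibuyaWeight (a : ℝ) (N : ℕ) :
    ∑ n ∈ Finset.range (N + 1), sibuyaWeight a n
      = 1 - ∏ k ∈ Finset.range N, (1 - a / ((k : ℝ) + 1)) := by
  have key : ∀ N : ℕ, ∏ k ∈ Finset.range N, (1 - a / ((k : ℝ) + 1))
      = (∏ k ∈ Finset.range N, ((k : ℝ) + 1 - a)) / (N.factorial : ℝ) := by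
    intro N
    induction N with
    | zero => simp
    | succ N ih =>
      rw [Finset.prod_range_succ, ih, Finset.prod_range_succ, Nat.factorial_succ]
      push_cast
      field_simp
  induction N with
  | zero => simp [sibuyaWeight]
  | succ N ih =>
    rw [Finset.sum_range_succ, ih, Finset.prod_range_succ, key N, sibuyaWeight, Nat.factorial_succ]
    push_cast
    field_simp
    ring

theorem hasSum_sibuyaWeight {a : ℝ} (h0 : 0 < a) (h1 : a < 1) : HasSum (sibuyaWeight a) 1 := by
  rw [hasSum_iff_tendsto_nat_of_nonneg (sibuyaWeight_nonneg h0 h1), ← tendsto_add_atTop_iff_nat 1]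
  simp only [sum_sibuyaWeight]
  have hle : ∀ N : ℕ, ∏ k ∈ Finset.range N, (1 - a / ((k : ℝ) + 1))
      ≤ Real.exp (-(a * ∑ k ∈ Finset.range N, 1 / ((k : ℝ) + 1))) := by
    intro N
    rw [Finset.mul_sum, ← Finset.sum_neg_distrib, Real.exp_sum]
    refine Finset.prod_le_prod (fun k _ => ?_) (fun k _ => ?_)
    · have hk : (0 : ℝ) < (k : ℝ) + 1 := by positivity
      have : a / ((k : ℝ) + 1) ≤ 1 := by
        rw [div_le_one hk]
        have : (0 : ℝ) ≤ k := by positivity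
        linarith
      linarith
    · have := Real.add_one_le_exp (-(a * (1 / ((k : ℝ) + 1))))
      have e : a * (1 / ((k : ℝ) + 1)) = a / ((k : ℝ) + 1) := by ring
      rw [e] at this ⊢
      linarith
  have hnn : ∀ N : ℕ, 0 ≤ ∏ k ∈ Finset.range N, (1 - a / ((k : ℝ) + 1)) := by
    intro N
    refine Finset.prod_nonneg fun k _ => ?_
    have hk : (0 : ℝ) < (k : ℝ) + 1 := by positivity
    have : a / ((k : ℝ) + 1) ≤ 1 := by
      rw [div_le_one hk]
      have : (0 : ℝ) ≤ k := by positivity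
      linarith
    linarith
  have hexp : Tendsto (fun N : ℕ => Real.exp (-(a * ∑ k ∈ Finset.range N, 1 / ((k : ℝ) + 1))))
      atTop (𝓝 0) :=
    Real.tendsto_exp_neg_atTop_nhds_zero.comp
      (Real.tendsto_sum_range_one_div_nat_succ_atTop.const_mul_atTop h0)
  have := (squeeze_zero hnn hle hexp).const_sub 1
  simpa using this

/-- The Sibuya distribution `s_a`, `0 < a < 1`, as a probability mass function on `ℕ`
(with no mass at `0`). -/
def sibuya (a : ℝ) (h0 : 0 < a) (h1 : a < 1) : PMF ℕ :=
  ⟨fun n => ENNReal.ofReal (sibuyaWeight a n), by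
    have h := hasSum_sibuyaWeight h0 h1
    have e := ENNReal.ofReal_tsum_of_nonneg (sibuyaWeight_nonneg h0 h1) h.summable
    rw [h.tsum_eq, ENNReal.ofReal_one] at e
    rw [e]
    exact ENNReal.summable.hasSum⟩

theorem sibuyaWeight_eq_choose (a : ℝ) (n : ℕ) :
    sibuyaWeight a (n + 1) = -((-1) ^ (n + 1) * Ring.choose a (n + 1)) := by
  have step : ∀ m : ℕ, Ring.choose a (m + 1) = Ring.choose a m * (a - m) / ((m : ℝ) + 1) := by
    intro m
    rw [Ring.choose_eq_smul, Ring.choose_eq_smul, descPochhammer_succ_right,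
      Polynomial.smeval_mul, Nat.factorial_succ]
    simp only [Polynomial.smeval_sub, Polynomial.smeval_X, Polynomial.smeval_natCast, smul_eq_mul,
      pow_one, pow_zero, nsmul_eq_mul, mul_one]
    push_cast
    field_simp
  induction n with
  | zero => simp [sibuyaWeight]
  | succ n ih =>
    have hw : sibuyaWeight a (n + 1 + 1)
        = sibuyaWeight a (n + 1) * ((n : ℝ) + 1 - a) / ((n : ℝ) + 2) := by
      simp only [sibuyaWeight]
      rw [Finset.prod_range_succ, Nat.factorial_succ (n + 1)]
      push_cast
      field_simp
      ring
    rw [hw, ih, step (n + 1)]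
    push_cast
    rw [pow_succ (-1 : ℝ) (n + 1)]
    have : (n : ℝ) + 1 + 1 = (n : ℝ) + 2 := by ring
    rw [this]
    ring

/-- The generating function of the Sibuya distribution is `1 - (1 - z) ^ a`. -/
theorem hasSum_sibuya_mul_pow {a : ℝ} (h0 : 0 < a) (h1 : a < 1) {z : ℝ} (hz : |z| < 1) :
    HasSum (fun n => (sibuya a h0 h1 n).toReal * z ^ n) (1 - (1 - z) ^ a) := by
  have hmem : -z ∈ Metric.eball (0 : ℝ) 1 := by
    rw [Metric.mem_eball, edist_zero_right, ← ofReal_norm, norm_neg, Real.norm_eq_abs]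
    rw [← ENNReal.ofReal_one]
    exact (ENNReal.ofReal_lt_ofReal_iff one_pos).2 hz
  have h := (Real.one_add_rpow_hasFPowerSeriesOnBall_zero (a := a)).hasSum hmem
  have hs : HasSum (fun n => Ring.choose a n * (-z) ^ n) ((1 - z) ^ a) := by
    have e : (1 : ℝ) + (0 + -z) = 1 - z := by ring
    rw [e] at h
    simpa [binomialSeries, FormalMultilinearSeries.coeff_ofScalars, mul_comm] using h
  have hd := (hasSum_ite_eq (0 : ℕ) (1 : ℝ)).sub hs
  refine hd.congr_fun ?_
  intro n
  have hv : (sibuya a h0 h1 n).toReal = sibuyaWeight a n :=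
    ENNReal.toReal_ofReal (sibuyaWeight_nonneg h0 h1 n)
  rw [hv]
  cases n with
  | zero => simp [sibuyaWeight]
  | succ n =>
    rw [sibuyaWeight_eq_choose, neg_pow z]
    simp
    ring

/-! ### Galton–Watson processes and their total progeny -/

/-- `X n k` (the number of children of the `k`-th individual of generation `n`) is a family of
independent `ℕ`-valued random variables, all with distribution `p`. -/
structure IsOffspringFamily {Ω : Type*} [MeasurableSpace Ω] (μ : Measure Ω) (p : PMF ℕ)
    (X : ℕ → ℕ → Ω → ℕ) : Prop where
  measurable : ∀ n k, Measurable (X n k)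
  law : ∀ n k, μ.map (X n k) = p.toMeasure
  indep : iIndepFun (fun nk : ℕ × ℕ => X nk.1 nk.2) μ

/-- The Galton–Watson process driven by the offspring numbers `X`:
`Z_0 = 1` and `Z_{n+1}` is the sum of the first `Z_n` of the variables `X n 0, X n 1, …`. -/
def galtonWatson {Ω : Type*} (X : ℕ → ℕ → Ω → ℕ) : ℕ → Ω → ℕ
  | 0, _ => 1
  | n + 1, ω => ∑ k ∈ Finset.range (galtonWatson X n ω), X n k ω

/-- The total progeny `∑ n, Z_n`, possibly infinite. -/
def totalProgeny {Ω : Type*} (X : ℕ → ℕ → Ω → ℕ) (ω : Ω) : ℝ≥0∞ :=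
  ∑' n, (galtonWatson X n ω : ℝ≥0∞)

/-- `q` is a progeny: there is a Galton–Watson process with `Z_0 = 1`, whose offspring
distribution `p` has mean at most `1`, and whose total progeny has distribution `q`. -/
def IsProgeny (q : PMF ℕ) : Prop :=
  ∃ p : PMF ℕ, ∑' n : ℕ, (n : ℝ≥0∞) * p n ≤ 1 ∧
    ∃ (Ω : Type) (_ : MeasurableSpace Ω) (μ : Measure Ω) (_ : IsProbabilityMeasure μ)
      (X : ℕ → ℕ → Ω → ℕ), IsOffspringFamily μ p X ∧
        ∀ n : ℕ, μ {ω | totalProgeny X ω = (n : ℝ≥0∞)} = q n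

/-! ### Power series with nonnegative coefficients -/

/-- `f`, given on a punctured neighbourhood of `0` in `ℝ`, is there the sum of a power series
with nonnegative coefficients. -/
def HasNonnegPowerSeries (f : ℝ → ℝ) : Prop :=
  ∃ c : ℕ → ℝ, (∀ n, 0 ≤ c n) ∧ ∀ᶠ u in 𝓝[≠] (0 : ℝ), HasSum (fun n => c n * u ^ n) (f u)

end

/-! Write `F_b(u) = u / (1 - (1 - u) ^ b)` and `b = 1 / a`. Everything reduces to two facts: `s_a`
is a progeny iff `1 ≤ b ≤ 2`, and `F_b` has nonnegative coefficients iff `1 ≤ b ≤ 2`.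

The total progeny has generating function `h` with `h(z) = z G(h(z))`, where `G` is that of the
offspring law (`tsum_totalProgeny_eq`). If `h(z) = 1 - (1 - z) ^ a`, then substituting `z = 1 - (1 -
u) ^ b` gives `h(z) = u` and forces `G = F_b`. Conversely, if `F_b` generates a probability law of
mean at most 1, the fixed-point equation can be solved for `h`, and it gives back `s_a`.

Sufficiency: for `1 ≤ b ≤ 2` all coefficients of `(1 - (1 - u) ^ b) / u` after the first are
nonpositive, so its reciprocal `F_b` has nonnegative ones.

Necessity: the first two coefficients force `b ≥ 1`. If `b > 2`, a Riccati equation makes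
nonnegative coefficients yield convergence on `(0, 1)`. There `F_b(1 - s) = 1 - s + O(s ^ b)` is
affine up to `o(s ^ 2)` at `s = 0`, while a positive quadratic coefficient gives second differences
of order `s ^ 2` (`le_two_of_mul_eq_X`). -/

/-! ### Power series tools -/

/-- Zeros of the difference accumulate at 0 from the right, so analyticity kills it. One-sided
hypotheses suffice, which matters because generating functions of random variables are only
evaluated at positive arguments. -/
theorem eq_of_eventually_hasSum_pow {a c : ℕ → ℝ} {f : ℝ → ℝ}
    (ha : ∀ᶠ u in 𝓝[>] (0 : ℝ), HasSum (fun n => a n * u ^ n) (f u))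
    (hc : ∀ᶠ u in 𝓝[>] (0 : ℝ), HasSum (fun n => c n * u ^ n) (f u)) : a = c := by
  have hd : ∀ᶠ u in 𝓝[>] (0 : ℝ), HasSum (fun n => (a - c) n * u ^ n) 0 := by
    filter_upwards [ha, hc] with u h1 h2
    simpa [sub_mul] using h1.sub h2
  obtain ⟨u₀, hu₀, hpos⟩ := (hd.and self_mem_nhdsWithin).exists
  have hpos : 0 < u₀ := hpos
  set p := FormalMultilinearSeries.ofScalars ℝ (a - c) with hp
  lift u₀ to NNReal using hpos.le
  have hrad : (u₀ : ℝ≥0∞) ≤ p.radius := by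
    refine p.le_radius_of_tendsto (l := 0) ?_
    have := hu₀.summable.tendsto_atTop_zero.norm
    simpa [hp, FormalMultilinearSeries.ofScalars_norm] using this
  have hrad' : 0 < p.radius := lt_of_lt_of_le (by simpa using hpos) hrad
  have hF := (p.hasFPowerSeriesOnBall hrad').hasFPowerSeriesAt
  have hfreq : ∃ᶠ u in 𝓝[≠] (0 : ℝ), p.sum u = 0 := by
    have hle : 𝓝[>] (0 : ℝ) ≤ 𝓝[≠] 0 := nhdsWithin_mono 0 fun x (hx : 0 < x) => hx.ne'
    refine Filter.Frequently.filter_mono (Filter.Eventually.frequently ?_) hle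
    filter_upwards [hd] with u hu
    rw [hp, FormalMultilinearSeries.sum]
    simpa [FormalMultilinearSeries.ofScalars_apply_eq, mul_comm] using hu.tsum_eq
  have hz := hF.analyticAt.frequently_zero_iff_eventually_zero.1 hfreq
  have := hF.eq_zero_of_eventually hz
  rw [hp, FormalMultilinearSeries.ofScalars_series_eq_zero] at this
  exact sub_eq_zero.1 this

theorem HasSum.mul_pow_coeff {a c : ℕ → ℝ} {u A C : ℝ} (ha : HasSum (fun n => a n * u ^ n) A)
    (hc : HasSum (fun n => c n * u ^ n) C) :
    HasSum (fun n => PowerSeries.coeff n (PowerSeries.mk a * PowerSeries.mk c) * u ^ n)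
      (A * C) := by
  have e : (fun n => PowerSeries.coeff n (PowerSeries.mk a * PowerSeries.mk c) * u ^ n)
      = fun n => ∑ kl ∈ Finset.HasAntidiagonal.antidiagonal n, (a kl.1 * u ^ kl.1) * (c kl.2 * u ^ kl.2) := by
    funext n
    rw [PowerSeries.coeff_mul, Finset.sum_mul]
    refine Finset.sum_congr rfl fun kl hkl => ?_
    rw [← Finset.HasAntidiagonal.mem_antidiagonal.1 hkl, pow_add]
    simp
    ring
  have h1 := summable_norm_sum_mul_antidiagonal_of_summable_norm ha.summable.norm hc.summable.norm
  have h2 := tsum_mul_tsum_eq_tsum_sum_antidiagonal_of_summable_norm ha.summable.norm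
    hc.summable.norm
  rw [e, ← ha.tsum_eq, ← hc.tsum_eq, h2]
  exact h1.of_norm.hasSum

theorem hasSum_sibuyaWeight_mul_pow (b : ℝ) {z : ℝ} (hz : |z| < 1) :
    HasSum (fun n => sibuyaWeight b n * z ^ n) (1 - (1 - z) ^ b) := by
  have hmem : -z ∈ Metric.eball (0 : ℝ) 1 := by
    rw [Metric.mem_eball, edist_zero_right, ← ofReal_norm, norm_neg, Real.norm_eq_abs,
      ← ENNReal.ofReal_one]
    exact (ENNReal.ofReal_lt_ofReal_iff one_pos).2 hz
  have h := (Real.one_add_rpow_hasFPowerSeriesOnBall_zero (a := b)).hasSum hmem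
  have hs : HasSum (fun n => Ring.choose b n * (-z) ^ n) ((1 - z) ^ b) := by
    have e : (1 : ℝ) + (0 + -z) = 1 - z := by ring
    rw [e] at h
    simpa [binomialSeries, FormalMultilinearSeries.coeff_ofScalars, mul_comm] using h
  refine ((hasSum_ite_eq (0 : ℕ) (1 : ℝ)).sub hs).congr_fun fun n => ?_
  cases n with
  | zero => simp [sibuyaWeight]
  | succ n =>
    rw [sibuyaWeight_eq_choose, neg_pow z]
    simp
    ring

theorem sibuyaWeight_succ_succ (b : ℝ) (n : ℕ) :
    sibuyaWeight b (n + 2) * ((n : ℝ) + 2) = sibuyaWeight b (n + 1) * ((n : ℝ) + 1 - b) := by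
  simp only [sibuyaWeight]
  rw [Finset.prod_range_succ, Nat.factorial_succ (n + 1)]
  push_cast
  field_simp
  ring

/-! ### The Riccati equation for the reciprocal series -/

section Riccati
open PowerSeries

theorem one_sub_X_mul_derivative_sibuyaWeight (b : ℝ) :
    (1 - X) * derivative ℝ (mk (sibuyaWeight b)) = C b * (1 - mk (sibuyaWeight b)) := by
  ext n
  rw [sub_mul, one_mul, map_sub, coeff_derivative, coeff_C_mul, map_sub, coeff_mk, coeff_mk]
  cases n with
  | zero => simp [sibuyaWeight]
  | succ n =>
    rw [coeff_succ_X_mul, coeff_derivative, coeff_mk, coeff_one]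
    have := sibuyaWeight_succ_succ b n
    push_cast
    simp
    linear_combination this

/-- With `D = 1 - (1 - u) ^ b`, eliminate `D` and `D'` from `c D = u`, its derivative, and the
linear equation `(1 - u) D' = b (1 - D)`. -/
theorem riccati_of_mul_eq_X {b : ℝ} {c : ℝ⟦X⟧} (h : c * mk (sibuyaWeight b) = X) :
    (1 - X) * (X * derivative ℝ c) + C b * c * c - C b * (X * c) = (1 - X) * c := by
  have h1 := congrArg (derivative ℝ) h
  rw [Derivation.leibniz, derivative_X, smul_eq_mul, smul_eq_mul] at h1
  have h2 := one_sub_X_mul_derivative_sibuyaWeight b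
  linear_combination (1 - X) * c * h1 - c ^ 2 * h2 - ((1 - X) * derivative ℝ c - C b * c) * h

theorem riccati_coeff_succ {b : ℝ} {c : ℕ → ℝ} (h : mk c * mk (sibuyaWeight b) = X) (n : ℕ) :
    (n : ℝ) * c (n + 1) + b * ∑ k ∈ Finset.HasAntidiagonal.antidiagonal (n + 1), c k.1 * c k.2
      = ((n : ℝ) - 1 + b) * c n := by
  have h1 := congrArg (coeff (n + 1)) (riccati_of_mul_eq_X h)
  rw [sub_mul, sub_mul, one_mul, one_mul, mul_assoc] at h1
  simp only [map_sub, map_add, coeff_succ_X_mul, coeff_C_mul, coeff_derivative, coeff_mk,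
    coeff_mul (n + 1) (mk c)] at h1
  cases n with
  | zero =>
    simp at h1 ⊢
    linarith
  | succ n =>
    simp only [coeff_succ_X_mul, coeff_derivative, coeff_mk] at h1
    push_cast at h1 ⊢
    linarith

end Riccati

/-! ### Nonnegative coefficients force `1 ≤ b ≤ 2` -/

section Necessity

variable {b : ℝ} {c : ℕ → ℝ}

theorem mk_mul_mk_sibuyaWeight_eq_X (hb : b ≠ 0)
    (h : ∀ᶠ u in 𝓝[>] (0 : ℝ), HasSum (fun n => c n * u ^ n) (u / (1 - (1 - u) ^ b))) :
    PowerSeries.mk c * PowerSeries.mk (sibuyaWeight b) = PowerSeries.X := by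
  have h1 : ∀ᶠ u in 𝓝[>] (0 : ℝ), u < 1 :=
    nhdsWithin_le_nhds (Iio_mem_nhds one_pos)
  have key : (fun n => PowerSeries.coeff n (PowerSeries.mk c * PowerSeries.mk (sibuyaWeight b)))
      = fun n => PowerSeries.coeff n (PowerSeries.X : PowerSeries ℝ) := by
    refine eq_of_eventually_hasSum_pow (f := fun u => u) ?_ ?_
    · filter_upwards [h, h1, self_mem_nhdsWithin] with u hu hu1 (hu0 : 0 < u)
      have := hu.mul_pow_coeff (hasSum_sibuyaWeight_mul_pow b (z := u) (by rwa [abs_of_pos hu0]))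
      rwa [div_mul_cancel₀] at this
      intro h0
      have h3 : (1 - u) ^ b = 1 := by linarith
      rcases hb.lt_or_gt with hb | hb
      · exact (Real.one_lt_rpow_of_pos_of_lt_one_of_neg (by linarith) (by linarith) hb).ne' h3
      · exact (Real.rpow_lt_one (by linarith) (by linarith) hb).ne h3
    · refine Eventually.of_forall fun u => ?_
      have := hasSum_single (f := fun n => PowerSeries.coeff n (PowerSeries.X : PowerSeries ℝ)
        * u ^ n) 1 (fun n hn => by simp [PowerSeries.coeff_X, hn])
      simpa using this
  ext n
  exact congrFun key n

variable (hX : PowerSeries.mk c * PowerSeries.mk (sibuyaWeight b) = PowerSeries.X)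
include hX

theorem coeff_zero_of_mul_eq_X : b * c 0 = 1 := by
  have := congrArg (PowerSeries.coeff 1) hX
  rw [PowerSeries.coeff_mul] at this
  simp [Finset.Nat.antidiagonal_succ, sibuyaWeight] at this
  linarith

theorem coeff_one_of_mul_eq_X : 2 * b * c 1 = b - 1 := by
  have h0 := coeff_zero_of_mul_eq_X hX
  have := riccati_coeff_succ hX 0
  simp [Finset.Nat.antidiagonal_succ] at this
  linear_combination b * this + (b - 1 - 2 * b * c 1) * h0

theorem coeff_two_of_mul_eq_X : 3 * c 2 = b * c 1 * (1 - c 1) := by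
  have h0 := coeff_zero_of_mul_eq_X hX
  have := riccati_coeff_succ hX 1
  simp [Finset.Nat.antidiagonal_succ] at this
  linear_combination this - 2 * c 2 * h0

/-- In the convolution of the Riccati recurrence keep only the two end terms, which contribute `2 *
c (n + 1)` since `b * c 0 = 1`; the others are nonnegative. The resulting ratio bound tends to 1, so
the radius of convergence is at least 1. -/
theorem coeff_succ_le_of_mul_eq_X (hb : 0 < b) (hc : ∀ n, 0 ≤ c n) (n : ℕ) :
    ((n : ℝ) + 2) * c (n + 1) ≤ ((n : ℝ) - 1 + b) * c n := by
  have h0 := coeff_zero_of_mul_eq_X hX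
  rw [← riccati_coeff_succ hX n]
  have h2 : c 0 * c (n + 1) + c (n + 1) * c 0
      ≤ ∑ k ∈ Finset.HasAntidiagonal.antidiagonal (n + 1), c k.1 * c k.2 := by
    have := Finset.sum_le_sum_of_subset_of_nonneg (s := {(0, n + 1), (n + 1, 0)})
      (t := Finset.HasAntidiagonal.antidiagonal (n + 1)) (f := fun k => c k.1 * c k.2)
      (by intro x; simp; rintro (rfl | rfl) <;> simp)
      (fun k _ _ => mul_nonneg (hc _) (hc _))
    rwa [Finset.sum_pair (by simp)] at this
  have h3 : b * (c 0 * c (n + 1) + c (n + 1) * c 0) = 2 * c (n + 1) := by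
    linear_combination 2 * c (n + 1) * h0
  linarith [mul_le_mul_of_nonneg_left h2 hb.le]

theorem summable_of_mul_eq_X (hb : 0 < b) (hc : ∀ n, 0 ≤ c n) {u : ℝ} (hu : |u| < 1) :
    Summable fun n => c n * u ^ n := by
  obtain ⟨r, hr1, hr2⟩ := exists_between hu
  refine summable_of_ratio_norm_eventually_le hr2 ?_
  have ht : Tendsto (fun n : ℕ => (r - |u|) * (n : ℝ)) atTop atTop :=
    tendsto_natCast_atTop_atTop.const_mul_atTop (by linarith)
  -- The threshold is a rearrangement of `|u| * (n - 1 + b) ≤ r * (n + 2)`.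
  filter_upwards [ht.eventually_ge_atTop (|u| * (b - 1) - 2 * r)] with n hn
  have h1 := coeff_succ_le_of_mul_eq_X hX hb hc n
  rw [norm_mul, norm_mul, norm_pow, norm_pow, Real.norm_eq_abs, Real.norm_eq_abs, Real.norm_eq_abs,
    abs_of_nonneg (hc _), abs_of_nonneg (hc _), pow_succ]
  have hpos : (0 : ℝ) < n + 2 := by positivity
  have h3 : |u| * c (n + 1) ≤ r * c n := by
    refine le_of_mul_le_mul_left ?_ hpos
    have := mul_le_mul_of_nonneg_left h1 (abs_nonneg u)
    nlinarith [hc n]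
  nlinarith [mul_le_mul_of_nonneg_right h3 (pow_nonneg (abs_nonneg u) n)]

theorem hasSum_of_mul_eq_X (hb : 0 < b) (hc : ∀ n, 0 ≤ c n) {u : ℝ} (hu0 : 0 < u) (hu : u < 1) :
    HasSum (fun n => c n * u ^ n) (u / (1 - (1 - u) ^ b)) := by
  have hu' : |u| < 1 := by rwa [abs_of_pos hu0]
  have hs := (summable_of_mul_eq_X hX hb hc hu').hasSum
  have h1 := hs.mul_pow_coeff (hasSum_sibuyaWeight_mul_pow b hu')
  rw [hX] at h1
  have h2 := hasSum_single (f := fun n => PowerSeries.coeff n (PowerSeries.X : PowerSeries ℝ)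
        * u ^ n) 1 (fun n hn => by simp [PowerSeries.coeff_X, hn])
  have h3 := h1.unique h2
  have h4 : (1 - u) ^ b < 1 := Real.rpow_lt_one (by linarith) (by linarith) hb
  have h5 := (eq_div_iff (by linarith)).2 h3
  simp only [PowerSeries.coeff_one_X, one_mul, pow_one] at h5
  rwa [h5] at hs

/-- Compare second differences of the sum at `1 - t`, `1 - 2t`, `1 - 3t`. Convexity makes every term
nonnegative, and the term `n = 2` alone equals `2 * c 2 * t ^ 2`. The affine part `1 - s` cancels,
leaving at most a constant times `t ^ b`. Dividing by `t ^ 2` and letting `t → 0` contradicts `c 2 >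
0` when `b > 2`. -/
theorem le_two_of_mul_eq_X (hb : 0 < b) (hc : ∀ n, 0 ≤ c n) : b ≤ 2 := by
  by_contra! hb2
  have h1 := coeff_one_of_mul_eq_X hX
  have h2 := coeff_two_of_mul_eq_X hX
  have hc1 : 0 < c 1 := by nlinarith
  have hc1' : c 1 < 1 := by nlinarith
  have hc2 : 0 < c 2 := by nlinarith [mul_pos (mul_pos hb hc1) (sub_pos.2 hc1')]
  -- The bound `1 / 6` keeps `3 * t` below `1 / 2`, where the two-sided estimate `hF` is available.
  have bound : ∀ t : ℝ, 0 < t → t < 1 / 6 → 2 * c 2 ≤ (2 + 2 * 3 ^ b) * t ^ (b - 2) := by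
    intro t ht ht6
    have hF : ∀ s : ℝ, 0 < s → s ≤ 1 / 2 → 1 - s ≤ (1 - s) / (1 - s ^ b) ∧
        (1 - s) / (1 - s ^ b) ≤ 1 - s + 2 * s ^ b := by
      intro s hs hs2
      have hp : 0 < s ^ b := Real.rpow_pos_of_pos hs b
      have hq : s ^ b ≤ 1 / 2 := by
        calc s ^ b ≤ s ^ (1 : ℝ) :=
              Real.rpow_le_rpow_of_exponent_ge hs (by linarith) (by linarith)
          _ ≤ 1 / 2 := by simpa using hs2
      constructor
      · rw [le_div_iff₀ (by linarith)]
        nlinarith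
      · rw [div_le_iff₀ (by linarith)]
        nlinarith
    have hS : ∀ s : ℝ, 0 < s → s ≤ 1 / 2 →
        HasSum (fun n => c n * (1 - s) ^ n) ((1 - s) / (1 - s ^ b)) := by
      intro s hs hs2
      have := hasSum_of_mul_eq_X hX hb hc (u := 1 - s) (by linarith) (by linarith)
      simpa using this
    have hsum := ((hS t ht (by linarith)).add (hS (3 * t) (by linarith) (by linarith))).sub
      ((hS (2 * t) (by linarith) (by linarith)).mul_left 2)
    have hle := le_hasSum hsum 2 fun n _ => by
      have hconv := (convexOn_pow (𝕜 := ℝ) n).2 (show 0 ≤ 1 - t by linarith)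
        (show 0 ≤ 1 - 3 * t by linarith) (show (0 : ℝ) ≤ 1 / 2 by norm_num)
        (show (0 : ℝ) ≤ 1 / 2 by norm_num) (by norm_num)
      simp only [smul_eq_mul] at hconv
      rw [show (1 / 2 : ℝ) * (1 - t) + 1 / 2 * (1 - 3 * t) = 1 - 2 * t by ring] at hconv
      nlinarith [mul_le_mul_of_nonneg_left hconv (hc n)]
    have f1 := (hF t ht (by linarith)).2
    have f2 := (hF (2 * t) (by linarith) (by linarith)).1
    have f3 := (hF (3 * t) (by linarith) (by linarith)).2
    rw [Real.mul_rpow (x := 3) (by norm_num) ht.le] at f3 hle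
    have ht2 : t ^ b = t ^ (b - 2) * t ^ 2 := by
      rw [← Real.rpow_natCast t 2, ← Real.rpow_add ht]
      norm_num
    have hfin : 2 * c 2 * t ^ 2 ≤ (2 + 2 * 3 ^ b) * t ^ (b - 2) * t ^ 2 := by
      rw [mul_assoc _ (t ^ (b - 2)), ← ht2]
      nlinarith
    exact le_of_mul_le_mul_right hfin (by positivity)
  have hlim : Tendsto (fun t : ℝ => (2 + 2 * 3 ^ b) * t ^ (b - 2)) (𝓝[>] 0) (𝓝 0) := by
    have : Tendsto (fun t : ℝ => t ^ (b - 2)) (𝓝 0) (𝓝 (0 ^ (b - 2))) :=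
      (Real.continuousAt_rpow_const 0 (b - 2) (Or.inr (by linarith))).tendsto
    rw [Real.zero_rpow (by linarith)] at this
    simpa using (this.mono_left nhdsWithin_le_nhds).const_mul (2 + 2 * 3 ^ b)
  have : 2 * c 2 ≤ 0 := by
    refine ge_of_tendsto hlim ?_
    have h6 : ∀ᶠ t in 𝓝[>] (0 : ℝ), t < 1 / 6 :=
      nhdsWithin_le_nhds (Iio_mem_nhds (by norm_num))
    filter_upwards [h6, self_mem_nhdsWithin] with t h6 h0 using bound t h0 h6
  linarith

omit hX in
theorem one_le_and_le_two_of_hasSum (hb : b ≠ 0) (hc : ∀ n, 0 ≤ c n)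
    (h : ∀ᶠ u in 𝓝[>] (0 : ℝ), HasSum (fun n => c n * u ^ n) (u / (1 - (1 - u) ^ b))) :
    1 ≤ b ∧ b ≤ 2 := by
  have hX := mk_mul_mk_sibuyaWeight_eq_X hb h
  have h0 := coeff_zero_of_mul_eq_X hX
  have hb0 : 0 < b := by
    by_contra! hneg
    nlinarith [hc 0]
  refine ⟨?_, le_two_of_mul_eq_X hX hb0 hc⟩
  have := coeff_one_of_mul_eq_X hX
  nlinarith [mul_nonneg hb0.le (hc 1)]

end Necessity

/-- The coefficients of the expansion of `u / (1 - (1 - u) ^ b)` at `u = 0`. -/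
noncomputable def invSibuyaCoeff (b : ℝ) (n : ℕ) : ℝ :=
  PowerSeries.coeff n (PowerSeries.mk fun n => sibuyaWeight b (n + 1))⁻¹

/-! ### For `1 ≤ b ≤ 2` the coefficients form an offspring law -/

section Sufficiency

variable {b : ℝ}

theorem mk_mul_mk_invSibuyaCoeff (hb : b ≠ 0) :
    (PowerSeries.mk fun n => sibuyaWeight b (n + 1)) * PowerSeries.mk (invSibuyaCoeff b) = 1 := by
  have e : PowerSeries.mk (invSibuyaCoeff b)
      = (PowerSeries.mk fun n => sibuyaWeight b (n + 1))⁻¹ := by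
    ext n
    simp [invSibuyaCoeff]
  rw [e]
  refine PowerSeries.mul_inv_cancel _ ?_
  rw [← PowerSeries.coeff_zero_eq_constantCoeff_apply, PowerSeries.coeff_mk]
  simpa [sibuyaWeight] using hb

theorem invSibuyaCoeff_zero (hb : b ≠ 0) : b * invSibuyaCoeff b 0 = 1 := by
  have := congrArg (PowerSeries.coeff 0) (mk_mul_mk_invSibuyaCoeff hb)
  rw [PowerSeries.coeff_mul] at this
  simpa [sibuyaWeight] using this

theorem invSibuyaCoeff_succ (hb : b ≠ 0) (n : ℕ) :
    b * invSibuyaCoeff b (n + 1)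
      = ∑ k ∈ Finset.range (n + 1), -sibuyaWeight b (k + 2) * invSibuyaCoeff b (n - k) := by
  have := congrArg (PowerSeries.coeff (n + 1)) (mk_mul_mk_invSibuyaCoeff hb)
  rw [PowerSeries.coeff_mul, Finset.Nat.sum_antidiagonal_eq_sum_range_succ_mk,
    Finset.sum_range_succ'] at this
  simp [sibuyaWeight, PowerSeries.coeff_one] at this
  simp only [neg_mul, Finset.sum_neg_distrib, sibuyaWeight]
  linarith

/-- The factor `1 - b` is the only nonpositive one; the later factors `2 - b, 3 - b, …` are
nonnegative. -/
theorem sibuyaWeight_add_two_nonpos (h1 : 1 ≤ b) (h2 : b ≤ 2) (n : ℕ) :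
    sibuyaWeight b (n + 2) ≤ 0 := by
  rw [sibuyaWeight, Finset.prod_range_succ']
  refine div_nonpos_of_nonpos_of_nonneg ?_ (by positivity)
  refine mul_nonpos_of_nonneg_of_nonpos (by linarith) (mul_nonpos_of_nonneg_of_nonpos ?_ ?_)
  · refine Finset.prod_nonneg fun k _ => ?_
    have : (0 : ℝ) ≤ k := by positivity
    push_cast
    linarith
  · simpa using h1

/-- The product formula for partial sums has exactly one nonpositive factor, `1 - b`, so the partial
sums of the weights are at least 1. This is what bounds the reciprocal's coefficients by 1, by
induction on their recursion. -/
theorem sum_neg_sibuyaWeight_le (h1 : 1 ≤ b) (h2 : b ≤ 2) (n : ℕ) :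
    ∑ k ∈ Finset.range n, -sibuyaWeight b (k + 2) ≤ b := by
  have h := sum_sibuyaWeight b (n + 1)
  rw [Finset.sum_range_succ', Finset.sum_range_succ', Finset.prod_range_succ'] at h
  have hp : (∏ k ∈ Finset.range n, (1 - b / (((k + 1 : ℕ) : ℝ) + 1)))
      * (1 - b / (((0 : ℕ) : ℝ) + 1)) ≤ 0 := by
    refine mul_nonpos_of_nonneg_of_nonpos (Finset.prod_nonneg fun k _ => ?_) (by simpa using h1)
    have : (0 : ℝ) ≤ k := by positivity
    rw [sub_nonneg, div_le_one (by positivity)]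
    push_cast
    linarith
  have e : sibuyaWeight b (0 + 1) + sibuyaWeight b 0 = b := by simp [sibuyaWeight]
  rw [Finset.sum_neg_distrib]
  linarith

theorem invSibuyaCoeff_nonneg (h1 : 1 ≤ b) (h2 : b ≤ 2) (n : ℕ) : 0 ≤ invSibuyaCoeff b n := by
  have hb : 0 < b := by linarith
  induction n using Nat.strong_induction_on with
  | _ n ih =>
    refine nonneg_of_mul_nonneg_right (a := b) ?_ hb
    cases n with
    | zero => rw [invSibuyaCoeff_zero hb.ne']; exact zero_le_one
    | succ n =>
      rw [invSibuyaCoeff_succ hb.ne']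
      refine Finset.sum_nonneg fun k _ => mul_nonneg ?_ (ih _ (by omega))
      linarith [sibuyaWeight_add_two_nonpos h1 h2 k]

theorem invSibuyaCoeff_le_one (h1 : 1 ≤ b) (h2 : b ≤ 2) (n : ℕ) : invSibuyaCoeff b n ≤ 1 := by
  have hb : 0 < b := by linarith
  induction n using Nat.strong_induction_on with
  | _ n ih =>
    refine le_of_mul_le_mul_left (a := b) ?_ hb
    cases n with
    | zero => rw [invSibuyaCoeff_zero hb.ne']; linarith
    | succ n =>
      rw [invSibuyaCoeff_succ hb.ne', mul_one]
      refine le_trans (Finset.sum_le_sum fun k _ => ?_) (sum_neg_sibuyaWeight_le h1 h2 (n + 1))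
      exact mul_le_of_le_one_right (by linarith [sibuyaWeight_add_two_nonpos h1 h2 k])
        (ih _ (by omega))

theorem hasSum_invSibuyaCoeff (h1 : 1 ≤ b) (h2 : b ≤ 2) {u : ℝ} (hu0 : u ≠ 0) (hu : |u| < 1) :
    HasSum (fun n => invSibuyaCoeff b n * u ^ n) (u / (1 - (1 - u) ^ b)) := by
  have hb : 0 < b := by linarith
  have hs : Summable fun n => invSibuyaCoeff b n * u ^ n := by
    refine Summable.of_norm_bounded (summable_geometric_of_lt_one (abs_nonneg u) hu) fun n => ?_
    rw [norm_mul, norm_pow, Real.norm_eq_abs, Real.norm_eq_abs,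
      abs_of_nonneg (invSibuyaCoeff_nonneg h1 h2 n)]
    exact mul_le_of_le_one_left (by positivity) (invSibuyaCoeff_le_one h1 h2 n)
  have hD : HasSum (fun n => sibuyaWeight b (n + 1) * u ^ n) ((1 - (1 - u) ^ b) / u) := by
    have h := hasSum_sibuyaWeight_mul_pow b hu
    rw [← hasSum_nat_add_iff' 1] at h
    have h3 := h.div_const u
    simp only [Finset.sum_range_one, sibuyaWeight, zero_mul, sub_zero] at h3
    refine h3.congr_fun fun n => ?_
    simp only [sibuyaWeight, pow_succ]
    field_simp
  have h3 := hD.mul_pow_coeff hs.hasSum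
  rw [mk_mul_mk_invSibuyaCoeff hb.ne'] at h3
  have h4 := hasSum_single (f := fun n => PowerSeries.coeff n (1 : PowerSeries ℝ)
        * u ^ n) 0 (fun n hn => by simp [PowerSeries.coeff_one, hn])
  have h5 := h3.unique h4
  simp at h5
  rw [← inv_div, ← eq_inv_of_mul_eq_one_right h5]
  exact hs.hasSum

theorem hasNonnegPowerSeries_iff (hb : b ≠ 0) :
    HasNonnegPowerSeries (fun u : ℝ => u / (1 - (1 - u) ^ b)) ↔ 1 ≤ b ∧ b ≤ 2 := by
  constructor
  · rintro ⟨c, hc, h⟩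
    have hle : 𝓝[>] (0 : ℝ) ≤ 𝓝[≠] 0 := nhdsWithin_mono 0 fun x (hx : 0 < x) => hx.ne'
    exact one_le_and_le_two_of_hasSum hb hc (hle h)
  · rintro ⟨h1, h2⟩
    refine ⟨invSibuyaCoeff b, invSibuyaCoeff_nonneg h1 h2, ?_⟩
    have h3 : ∀ᶠ u in 𝓝[≠] (0 : ℝ), |u| < 1 := by
      refine nhdsWithin_le_nhds ?_
      simpa [Metric.ball, Real.dist_eq] using Metric.ball_mem_nhds (0 : ℝ) one_pos
    filter_upwards [h3, self_mem_nhdsWithin] with u hu hu0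
    exact hasSum_invSibuyaCoeff h1 h2 hu0 hu

theorem tendsto_div_one_sub_rpow (hb : 0 < b) :
    Tendsto (fun u : ℝ => u / (1 - (1 - u) ^ b)) (𝓝[<] 1) (𝓝 1) := by
  have h : Tendsto (fun u : ℝ => (1 - u) ^ b) (𝓝 1) (𝓝 ((1 - 1) ^ b)) :=
    (tendsto_const_nhds.sub tendsto_id).rpow_const (Or.inr hb.le)
  rw [sub_self, Real.zero_rpow hb.ne'] at h
  have h2 : Tendsto (fun u : ℝ => u / (1 - (1 - u) ^ b)) (𝓝 1) (𝓝 (1 / (1 - 0))) :=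
    tendsto_id.div (tendsto_const_nhds.sub h) (by norm_num)
  rw [sub_zero, div_one] at h2
  exact h2.mono_left nhdsWithin_le_nhds

theorem eventually_nhdsLT_one_pos_lt : ∀ᶠ u in 𝓝[<] (1 : ℝ), 0 < u ∧ u < 1 := by
  filter_upwards [nhdsWithin_le_nhds (Ioi_mem_nhds (zero_lt_one (α := ℝ))), self_mem_nhdsWithin]
    with u h0 h1 using ⟨h0, h1⟩

theorem sum_invSibuyaCoeff_le_one (h1 : 1 ≤ b) (h2 : b ≤ 2) (s : Finset ℕ) :
    ∑ n ∈ s, invSibuyaCoeff b n ≤ 1 := by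
  have hl : Tendsto (fun u : ℝ => ∑ n ∈ s, invSibuyaCoeff b n * u ^ n) (𝓝[<] 1)
      (𝓝 (∑ n ∈ s, invSibuyaCoeff b n * 1 ^ n)) :=
    (Continuous.tendsto (by fun_prop) 1).mono_left nhdsWithin_le_nhds
  simp only [one_pow, mul_one] at hl
  refine le_of_tendsto_of_tendsto hl (tendsto_div_one_sub_rpow (b := b) (by linarith)) ?_
  filter_upwards [eventually_nhdsLT_one_pos_lt] with u ⟨h0, hu⟩
  exact sum_le_hasSum s
    (fun n _ => mul_nonneg (invSibuyaCoeff_nonneg h1 h2 n) (by positivity))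
    (hasSum_invSibuyaCoeff h1 h2 h0.ne' (by rwa [abs_of_pos h0]))

/-- Abel's theorem identifies the sum with the limit of `F_b` at `1`. -/
theorem hasSum_invSibuyaCoeff_one (h1 : 1 ≤ b) (h2 : b ≤ 2) : HasSum (invSibuyaCoeff b) 1 := by
  have hs : Summable (invSibuyaCoeff b) :=
    summable_of_sum_le (invSibuyaCoeff_nonneg h1 h2) (sum_invSibuyaCoeff_le_one h1 h2)
  have hl := Real.tendsto_tsum_powerSeries_nhdsWithin_lt hs.hasSum.tendsto_sum_nat
  have hl' : Tendsto (fun u : ℝ => u / (1 - (1 - u) ^ b)) (𝓝[<] 1)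
      (𝓝 (∑' n, invSibuyaCoeff b n)) := by
    refine hl.congr' ?_
    filter_upwards [eventually_nhdsLT_one_pos_lt] with u ⟨h0, hu⟩
    exact (hasSum_invSibuyaCoeff h1 h2 h0.ne' (by rwa [abs_of_pos h0])).tsum_eq
  rw [tendsto_nhds_unique (tendsto_div_one_sub_rpow (b := b) (by linarith)) hl']
  exact hs.hasSum

/-- The mean is approached through difference quotients `(1 - F_b(u)) / (1 - u)` as `u → 1`, and
these are at most 1 because `F_b(u) ≥ u`. -/
theorem sum_mul_invSibuyaCoeff_le_one (h1 : 1 ≤ b) (h2 : b ≤ 2) (s : Finset ℕ) :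
    ∑ n ∈ s, (n : ℝ) * invSibuyaCoeff b n ≤ 1 := by
  have hl : Tendsto (fun u : ℝ => ∑ n ∈ s, (∑ i ∈ Finset.range n, u ^ i) * invSibuyaCoeff b n)
      (𝓝[<] 1) (𝓝 (∑ n ∈ s, (∑ i ∈ Finset.range n, 1 ^ i) * invSibuyaCoeff b n)) :=
    (Continuous.tendsto (by fun_prop) 1).mono_left nhdsWithin_le_nhds
  simp only [one_pow, Finset.sum_const, Finset.card_range, nsmul_eq_mul, mul_one] at hl
  refine le_of_tendsto hl ?_
  filter_upwards [eventually_nhdsLT_one_pos_lt] with u ⟨h0, hu⟩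
  have hsum := (hasSum_invSibuyaCoeff_one h1 h2).sub
    (hasSum_invSibuyaCoeff h1 h2 h0.ne' (by rwa [abs_of_pos h0]))
  have e : ∀ n, invSibuyaCoeff b n - invSibuyaCoeff b n * u ^ n
      = (1 - u) * ((∑ i ∈ Finset.range n, u ^ i) * invSibuyaCoeff b n) := fun n => by
    linear_combination -invSibuyaCoeff b n * mul_neg_geom_sum u n
  simp only [e] at hsum
  have h3 := sum_le_hasSum s (fun n _ => mul_nonneg (by linarith)
    (mul_nonneg (by positivity) (invSibuyaCoeff_nonneg h1 h2 n))) hsum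
  rw [← Finset.mul_sum] at h3
  have hp : 0 ≤ (1 - u) ^ b := by apply Real.rpow_nonneg; linarith
  have hq : (1 - u) ^ b < 1 := Real.rpow_lt_one (by linarith) (by linarith) (by linarith)
  have h4 : u ≤ u / (1 - (1 - u) ^ b) := by
    rw [le_div_iff₀ (by linarith)]
    nlinarith
  refine le_of_mul_le_mul_left (a := 1 - u) ?_ (by linarith)
  linarith

/-- The offspring distribution whose generating function is `u / (1 - (1 - u) ^ b)`. -/
noncomputable def invSibuya (b : ℝ) (h1 : 1 ≤ b) (h2 : b ≤ 2) : PMF ℕ :=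
  ⟨fun n => ENNReal.ofReal (invSibuyaCoeff b n), by
    have h := hasSum_invSibuyaCoeff_one h1 h2
    have e := ENNReal.ofReal_tsum_of_nonneg (invSibuyaCoeff_nonneg h1 h2) h.summable
    rw [h.tsum_eq, ENNReal.ofReal_one] at e
    rw [e]
    exact ENNReal.summable.hasSum⟩

theorem invSibuya_apply (h1 : 1 ≤ b) (h2 : b ≤ 2) (n : ℕ) :
    invSibuya b h1 h2 n = ENNReal.ofReal (invSibuyaCoeff b n) := rfl

theorem tsum_mul_invSibuya_le_one (h1 : 1 ≤ b) (h2 : b ≤ 2) :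
    ∑' n : ℕ, (n : ℝ≥0∞) * invSibuya b h1 h2 n ≤ 1 := by
  have hnn : ∀ n : ℕ, 0 ≤ (n : ℝ) * invSibuyaCoeff b n := fun n =>
    mul_nonneg n.cast_nonneg (invSibuyaCoeff_nonneg h1 h2 n)
  have hs := summable_of_sum_le hnn (sum_mul_invSibuyaCoeff_le_one h1 h2)
  have e : ∀ n : ℕ, (n : ℝ≥0∞) * invSibuya b h1 h2 n
      = ENNReal.ofReal ((n : ℝ) * invSibuyaCoeff b n) := fun n => by
    rw [invSibuya_apply, ENNReal.ofReal_mul n.cast_nonneg, ENNReal.ofReal_natCast]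
  simp only [e]
  rw [← ENNReal.ofReal_tsum_of_nonneg hnn hs, ENNReal.ofReal_le_one]
  exact hs.tsum_le_of_sum_le (sum_mul_invSibuyaCoeff_le_one h1 h2)

end Sufficiency

/-! ### Generating function of the total progeny -/

/-- The σ-algebra is arbitrary so that it can be the one generated by the generations before `N`. -/
theorem measurable_galtonWatson {Ω : Type*} {m : MeasurableSpace Ω} {X : ℕ → ℕ → Ω → ℕ} {N : ℕ}
    (h : ∀ n < N, ∀ k, Measurable (X n k)) {n : ℕ} (hn : n ≤ N) :
    Measurable (galtonWatson X n) := by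
  induction n with
  | zero => exact measurable_const
  | succ n ih =>
    have h1 : Measurable fun x : ℕ × Ω => ∑ k ∈ Finset.range x.1, X n k x.2 :=
      measurable_from_prod_countable_right fun i => by
        change Measurable fun y => ∑ k ∈ Finset.range i, X n k y
        exact Finset.measurable_sum _ fun k _ => h n (by omega) k
    exact h1.comp ((ih (by omega)).prodMk measurable_id)

namespace IsOffspringFamily

variable {Ω : Type*} [MeasurableSpace Ω] {μ : Measure Ω} [IsProbabilityMeasure μ] {p : PMF ℕ}
  {X : ℕ → ℕ → Ω → ℕ}

omit [IsProbabilityMeasure μ] in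
/-- The offspring numbers of generation `N` are independent of all earlier generations. -/
theorem indep_iSup (hX : IsOffspringFamily μ p X) (N : ℕ) :
    Indep (⨆ nk ∈ {nk : ℕ × ℕ | nk.1 < N}, MeasurableSpace.comap (X nk.1 nk.2) inferInstance)
      (⨆ nk ∈ {nk : ℕ × ℕ | nk.1 = N}, MeasurableSpace.comap (X nk.1 nk.2) inferInstance) μ := by
  have h := (iIndepFun_iff_iIndep _ _ _).1 hX.indep
  have hd : Disjoint {nk : ℕ × ℕ | nk.1 < N} {nk : ℕ × ℕ | nk.1 = N} :=
    Set.disjoint_left.2 fun nk h1 h2 => (Nat.lt_irrefl N) (by simp_all)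
  exact indep_iSup_of_disjoint
    (m := fun nk : ℕ × ℕ => MeasurableSpace.comap (X nk.1 nk.2) inferInstance)
    (fun nk => (hX.measurable nk.1 nk.2).comap_le) h hd

omit [MeasurableSpace Ω] in
theorem measurable_iSup_comap {S : Set (ℕ × ℕ)} {n k : ℕ} (h : (n, k) ∈ S) :
    Measurable[⨆ nk ∈ S, MeasurableSpace.comap (X nk.1 nk.2) inferInstance] (X n k) :=
  Measurable.of_comap_le (le_iSup₂_of_le (n, k) h le_rfl)

omit [IsProbabilityMeasure μ] in
theorem lintegral_prod_pow (hX : IsOffspringFamily μ p X) (w : ℝ≥0∞) (n m : ℕ) :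
    ∫⁻ ω, ∏ k ∈ Finset.range m, w ^ X n k ω ∂μ = (∫⁻ x, w ^ x ∂p.toMeasure) ^ m := by
  have hpow : Measurable fun x : ℕ => w ^ x := measurable_from_top
  have hi : iIndepFun (fun k => X n k) μ :=
    hX.indep.precomp (g := fun k => (n, k)) fun i j h => by simpa using h
  rw [lintegral_prod_eq_prod_lintegral_of_indepFun (Finset.range m) (fun k ω => w ^ X n k ω)
    (hi.comp (fun _ x => w ^ x) fun _ => hpow) fun k => hpow.comp (hX.measurable n k)]
  have e : ∀ k, ∫⁻ ω, w ^ X n k ω ∂μ = ∫⁻ x, w ^ x ∂p.toMeasure := fun k => by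
    rw [← hX.law n k, lintegral_map hpow (hX.measurable n k)]
  simp [e]

omit [IsProbabilityMeasure μ] in
-- Conditioning on the past: given generations before `N`, the size of generation `N + 1` is a sum
-- of `Z_N` independent variables, so `w` is replaced by `z * G(w)`.
theorem lintegral_pow_mul_pow_succ (hX : IsOffspringFamily μ p X) (z w : ℝ≥0∞) (N : ℕ) :
    ∫⁻ ω, z ^ (∑ n ∈ Finset.range (N + 1), galtonWatson X n ω) * w ^ galtonWatson X (N + 1) ω ∂μ
      = ∫⁻ ω, z ^ (∑ n ∈ Finset.range N, galtonWatson X n ω)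
          * (z * ∫⁻ x, w ^ x ∂p.toMeasure) ^ galtonWatson X N ω ∂μ := by
  set G := ∫⁻ x, w ^ x ∂p.toMeasure
  have hpow : ∀ y : ℝ≥0∞, Measurable fun x : ℕ => y ^ x := fun y => measurable_from_top
  -- Slicing along `Z_N = m` turns a random number of factors into a fixed one, so that independence
  -- applies to each slice.
  set A : ℕ → Ω → ℝ≥0∞ := fun m ω => if galtonWatson X N ω = m then
    z ^ (∑ n ∈ Finset.range N, galtonWatson X n ω) * z ^ m else 0
  have hA : ∀ m, Measurable[⨆ nk ∈ {nk : ℕ × ℕ | nk.1 < N},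
      MeasurableSpace.comap (X nk.1 nk.2) inferInstance] (A m) := fun m => by
    have hZ : ∀ n ≤ N, Measurable[⨆ nk ∈ {nk : ℕ × ℕ | nk.1 < N},
        MeasurableSpace.comap (X nk.1 nk.2) inferInstance] (galtonWatson X n) := fun n hn =>
      measurable_galtonWatson (N := N) (fun n hn k => measurable_iSup_comap hn) hn
    refine Measurable.ite (hZ N le_rfl (measurableSet_singleton m)) ?_ measurable_const
    refine Measurable.mul_const ((hpow z).comp (Finset.measurable_sum _ fun n hn => ?_)) _
    exact hZ n (Finset.mem_range.1 hn).le
  have hB : ∀ m, Measurable[⨆ nk ∈ {nk : ℕ × ℕ | nk.1 = N},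
      MeasurableSpace.comap (X nk.1 nk.2) inferInstance] fun ω => ∏ k ∈ Finset.range m, w ^ X N k ω :=
    fun m => Finset.measurable_prod _ fun k _ =>
      (hpow w).comp (measurable_iSup_comap (show ((N, k) : ℕ × ℕ).1 = N from rfl))
  have hle : ∀ S : Set (ℕ × ℕ), ⨆ nk ∈ S, MeasurableSpace.comap (X nk.1 nk.2) inferInstance ≤ ‹_› :=
    fun S => iSup₂_le fun nk _ => (hX.measurable nk.1 nk.2).comap_le
  have hAm := fun m => (hA m).mono (hle _) le_rfl
  have hBm := fun m => (hB m).mono (hle _) le_rfl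
  calc ∫⁻ ω, z ^ (∑ n ∈ Finset.range (N + 1), galtonWatson X n ω)
        * w ^ galtonWatson X (N + 1) ω ∂μ
      = ∫⁻ ω, ∑' m, A m ω * ∏ k ∈ Finset.range m, w ^ X N k ω ∂μ := by
        refine lintegral_congr fun ω => ?_
        rw [tsum_eq_single (galtonWatson X N ω) fun m hm => by simp [A, hm.symm]]
        simp only [A, if_true]
        rw [Finset.sum_range_succ, pow_add, galtonWatson, Finset.prod_pow_eq_pow_sum]
    _ = ∑' m, ∫⁻ ω, A m ω * ∏ k ∈ Finset.range m, w ^ X N k ω ∂μ :=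
        lintegral_tsum fun m => ((hAm m).mul (hBm m)).aemeasurable
    _ = ∑' m, ∫⁻ ω, A m ω * G ^ m ∂μ := by
        refine tsum_congr fun m => ?_
        rw [lintegral_mul_eq_lintegral_mul_lintegral_of_independent_measurableSpace (hle _) (hle _)
          (hX.indep_iSup N) (hA m) (hB m), hX.lintegral_prod_pow, lintegral_mul_const _ (hAm m)]
    _ = ∫⁻ ω, ∑' m, A m ω * G ^ m ∂μ :=
        (lintegral_tsum fun m => ((hAm m).mul_const _).aemeasurable).symm
    _ = _ := by
        refine lintegral_congr fun ω => ?_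
        rw [tsum_eq_single (galtonWatson X N ω) fun m hm => by simp [A, hm.symm]]
        simp only [A, if_true]
        rw [mul_pow, mul_assoc]

theorem lintegral_pow_mul_pow (hX : IsOffspringFamily μ p X) (z w : ℝ≥0∞) (N : ℕ) :
    ∫⁻ ω, z ^ (∑ n ∈ Finset.range N, galtonWatson X n ω) * w ^ galtonWatson X N ω ∂μ
      = (fun v => z * ∫⁻ x, v ^ x ∂p.toMeasure)^[N] w := by
  induction N generalizing w with
  | zero => simp [galtonWatson]
  | succ N ih => rw [hX.lintegral_pow_mul_pow_succ, ih, Function.iterate_succ_apply]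

theorem lintegral_pow_sum_succ (hX : IsOffspringFamily μ p X) (z : ℝ≥0∞) (N : ℕ) :
    ∫⁻ ω, z ^ (∑ n ∈ Finset.range (N + 2), galtonWatson X n ω) ∂μ
      = z * ∫⁻ x, (∫⁻ ω, z ^ (∑ n ∈ Finset.range (N + 1), galtonWatson X n ω) ∂μ) ^ x
          ∂p.toMeasure := by
  have e : ∀ M, ∫⁻ ω, z ^ (∑ n ∈ Finset.range (M + 1), galtonWatson X n ω) ∂μ
      = (fun v => z * ∫⁻ x, v ^ x ∂p.toMeasure)^[M] z := fun M => by
    rw [← hX.lintegral_pow_mul_pow z z M]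
    simp only [Finset.sum_range_succ _ M, pow_add]
  rw [e (N + 1), e N, Function.iterate_succ_apply']

omit [IsProbabilityMeasure μ] in
theorem measurable_totalProgeny (hX : IsOffspringFamily μ p X) : Measurable (totalProgeny X) := by
  refine Measurable.tsum fun n => ?_
  exact measurable_from_top.comp
    (measurable_galtonWatson (N := n) (fun n _ k => hX.measurable n k) le_rfl)

omit [MeasurableSpace Ω] in
-- The partial totals are monotone integers: they either stabilise at the total progeny or diverge.
-- In the latter case both the power and the sum of indicators vanish in the limit.
theorem tendsto_pow_sum_galtonWatson {z : ℝ≥0∞} (hz : z < 1) (ω : Ω) :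
    Tendsto (fun N => z ^ (∑ n ∈ Finset.range N, galtonWatson X n ω)) atTop
      (𝓝 (∑' n : ℕ, if totalProgeny X ω = n then z ^ n else 0)) := by
  have hT : Tendsto (fun N => ((∑ n ∈ Finset.range N, galtonWatson X n ω : ℕ) : ℝ≥0∞)) atTop
      (𝓝 (totalProgeny X ω)) := by
    simpa [totalProgeny] using
      ENNReal.tendsto_nat_tsum (fun n => (galtonWatson X n ω : ℝ≥0∞))
  have hmono : Monotone fun N => ∑ n ∈ Finset.range N, galtonWatson X n ω :=
    monotone_nat_of_le_succ fun N => by simp [Finset.sum_range_succ]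
  rcases tendsto_atTop_of_monotone hmono with h | ⟨l, h⟩
  · have htop := tendsto_nhds_unique hT (ENNReal.tendsto_nat_nhds_top.comp h)
    simp only [htop, ENNReal.top_ne_natCast, if_false, tsum_zero]
    exact (ENNReal.tendsto_pow_atTop_nhds_zero_of_lt_one hz).comp h
  · rw [nhds_discrete, tendsto_pure] at h
    have hl : totalProgeny X ω = l := by
      refine tendsto_nhds_unique hT (tendsto_const_nhds.congr' ?_)
      filter_upwards [h] with N hN
      rw [hN]
    have e : ∑' n : ℕ, (if totalProgeny X ω = n then z ^ n else 0) = z ^ l := by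
      rw [tsum_eq_single l fun n hn => by simp [hl, hn.symm]]
      simp [hl]
    rw [e]
    refine tendsto_const_nhds.congr' ?_
    filter_upwards [h] with N hN
    rw [hN]

theorem tendsto_lintegral_pow_sum (hX : IsOffspringFamily μ p X) {z : ℝ≥0∞} (hz : z < 1) :
    Tendsto (fun N => ∫⁻ ω, z ^ (∑ n ∈ Finset.range N, galtonWatson X n ω) ∂μ) atTop
      (𝓝 (∑' n : ℕ, μ {ω | totalProgeny X ω = n} * z ^ n)) := by
  have hm : ∀ n : ℕ, MeasurableSet {ω | totalProgeny X ω = n} := fun n =>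
    hX.measurable_totalProgeny (measurableSet_singleton _)
  have e : ∑' n : ℕ, μ {ω | totalProgeny X ω = n} * z ^ n
      = ∫⁻ ω, ∑' n : ℕ, (if totalProgeny X ω = n then z ^ n else 0) ∂μ := by
    rw [lintegral_tsum fun n =>
      (Measurable.ite (hm n) measurable_const measurable_const).aemeasurable]
    refine tsum_congr fun n => ?_
    rw [mul_comm, ← lintegral_indicator_const (hm n)]
    simp only [Set.indicator_apply, Set.mem_ofPred_eq]
  rw [e]
  refine tendsto_lintegral_of_dominated_convergence (fun _ => 1) (fun N => ?_) (fun N => ?_)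
    (by simp) (Eventually.of_forall fun ω => tendsto_pow_sum_galtonWatson hz ω)
  · refine measurable_from_top.comp (g := fun x : ℕ => z ^ x) (Finset.measurable_sum _ fun n _ => ?_)
    exact measurable_galtonWatson (N := n) (fun n _ k => hX.measurable n k) le_rfl
  · exact Eventually.of_forall fun ω => pow_le_one₀ zero_le hz.le

theorem lintegral_pow_sum_le_one {z : ℝ≥0∞} (hz : z < 1) (N : ℕ) :
    ∫⁻ ω, z ^ (∑ n ∈ Finset.range N, galtonWatson X n ω) ∂μ ≤ 1 := by
  calc ∫⁻ ω, z ^ (∑ n ∈ Finset.range N, galtonWatson X n ω) ∂μ ≤ ∫⁻ _, 1 ∂μ :=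
        lintegral_mono fun ω => pow_le_one₀ zero_le hz.le
    _ = 1 := by simp

/-- The generating function `h` of the total progeny satisfies `h(z) = z G(h(z))`, with `G` the
generating function of the offspring distribution. -/
theorem tsum_totalProgeny_eq (hX : IsOffspringFamily μ p X) {z : ℝ≥0∞} (hz : z < 1) :
    ∑' n : ℕ, μ {ω | totalProgeny X ω = n} * z ^ n
      = z * ∑' k : ℕ, p k * (∑' n : ℕ, μ {ω | totalProgeny X ω = n} * z ^ n) ^ k := by
  set H := ∑' n : ℕ, μ {ω | totalProgeny X ω = n} * z ^ n
  have hlim := hX.tendsto_lintegral_pow_sum hz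
  have h1 := hlim.comp (tendsto_add_atTop_nat 1)
  have h2 := hlim.comp (tendsto_add_atTop_nat 2)
  have h3 : Tendsto (fun N => ∫⁻ x, (∫⁻ ω, z ^ (∑ n ∈ Finset.range (N + 1), galtonWatson X n ω) ∂μ)
      ^ x ∂p.toMeasure) atTop (𝓝 (∫⁻ x, H ^ x ∂p.toMeasure)) := by
    refine tendsto_lintegral_of_dominated_convergence (fun _ => 1) (fun N => measurable_from_top)
      (fun N => Eventually.of_forall fun x => pow_le_one₀ zero_le (lintegral_pow_sum_le_one hz _))
      (by simp) (Eventually.of_forall fun x => ?_)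
    exact ((ENNReal.continuous_pow x).tendsto H).comp h1
  have h4 := ENNReal.Tendsto.const_mul (a := z) h3 (Or.inr (hz.trans ENNReal.one_lt_top).ne)
  have h5 := tendsto_nhds_unique h2 (h4.congr fun N => (hX.lintegral_pow_sum_succ z N).symm)
  rw [lintegral_countable'] at h5
  refine h5.trans ?_
  simp [PMF.toMeasure_apply_singleton, mul_comm]

theorem exists_hasSum_totalProgeny (hX : IsOffspringFamily μ p X) {z : ℝ} (hz0 : 0 < z)
    (hz1 : z < 1) :
    ∃ h : ℝ, 0 ≤ h ∧ h ≤ z ∧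
      HasSum (fun n : ℕ => (μ {ω | totalProgeny X ω = n}).toReal * z ^ n) h ∧
      HasSum (fun n => (p n).toReal * h ^ n) (h / z) := by
  have hz : ENNReal.ofReal z < 1 := by rwa [ENNReal.ofReal_lt_one]
  have hfix := hX.tsum_totalProgeny_eq hz
  have hH1 := le_of_tendsto (hX.tendsto_lintegral_pow_sum hz)
    (Eventually.of_forall fun N => lintegral_pow_sum_le_one hz N)
  set H := ∑' n : ℕ, μ {ω | totalProgeny X ω = n} * ENNReal.ofReal z ^ n with hH
  have hG1 : ∑' k : ℕ, p k * H ^ k ≤ 1 := by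
    rw [← p.tsum_coe]
    exact ENNReal.tsum_le_tsum fun k => mul_le_of_le_one_right zero_le (pow_le_one₀ zero_le hH1)
  have hHtop : H ≠ ⊤ := (hH1.trans_lt ENNReal.one_lt_top).ne
  have hGtop : ∑' k : ℕ, p k * H ^ k ≠ ⊤ := (hG1.trans_lt ENNReal.one_lt_top).ne
  have hfix' : H.toReal = z * (∑' k : ℕ, p k * H ^ k).toReal := by
    conv_lhs => rw [hfix]
    rw [ENNReal.toReal_mul, ENNReal.toReal_ofReal hz0.le]
  refine ⟨H.toReal, ENNReal.toReal_nonneg, ?_, ?_, ?_⟩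
  · rw [hfix']
    exact mul_le_of_le_one_right hz0.le (by simpa using ENNReal.toReal_mono ENNReal.one_ne_top hG1)
  · have := ENNReal.hasSum_toReal hHtop
    rw [← ENNReal.tsum_toReal_eq (ENNReal.ne_top_of_tsum_ne_top hHtop)] at this
    simpa [ENNReal.toReal_ofReal hz0.le] using this
  · have := ENNReal.hasSum_toReal hGtop
    rw [← ENNReal.tsum_toReal_eq (ENNReal.ne_top_of_tsum_ne_top hGtop)] at this
    rw [hfix', mul_div_cancel_left₀ _ hz0.ne', ← hfix']
    simpa using this

end IsOffspringFamily

/-! ### Which Sibuya laws are progenies -/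

theorem isOffspringFamily_infinitePi (p : PMF ℕ) :
    IsOffspringFamily (Measure.infinitePi fun _ : ℕ × ℕ => p.toMeasure) p
      fun n k ω => ω (n, k) where
  measurable _ _ := measurable_pi_apply _
  law n k := Measure.infinitePi_map_eval (fun _ : ℕ × ℕ => p.toMeasure) (n, k)
  indep := iIndepFun_infinitePi (X := fun _ x => x) fun _ => measurable_id

theorem one_sub_rpow_one_div {a u : ℝ} (ha : a ≠ 0) (hu : u ≤ 1) :
    1 - (1 - (1 - (1 - u) ^ (1 / a))) ^ a = u := by
  rw [sub_sub_cancel, ← Real.rpow_mul (by linarith), one_div_mul_cancel ha, Real.rpow_one,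
    sub_sub_cancel]

theorem isProgeny_sibuya_iff {a : ℝ} (h0 : 0 < a) (h1 : a < 1) :
    IsProgeny (sibuya a h0 h1) ↔ 1 ≤ 1 / a ∧ 1 / a ≤ 2 := by
  have hb : 0 < 1 / a := by positivity
  constructor
  · rintro ⟨p, -, Ω, _, μ, _, X, hX, hq⟩
    refine one_le_and_le_two_of_hasSum hb.ne' (c := fun n => (p n).toReal)
      (fun n => ENNReal.toReal_nonneg) ?_
    filter_upwards [nhdsWithin_le_nhds (Iio_mem_nhds (zero_lt_one (α := ℝ))), self_mem_nhdsWithin]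
      with u (hu1 : u < 1) (hu0 : 0 < u)
    have hp : 0 < (1 - u) ^ (1 / a) := Real.rpow_pos_of_pos (by linarith) _
    have hq1 : (1 - u) ^ (1 / a) < 1 := Real.rpow_lt_one (by linarith) (by linarith) hb
    -- This `z` is the preimage of `u` under `z ↦ 1 - (1 - z) ^ a`, so `h = u` and `hG` reads `G(u)
    -- = u / z`.
    obtain ⟨h, -, -, hs, hG⟩ := hX.exists_hasSum_totalProgeny
      (z := 1 - (1 - u) ^ (1 / a)) (by linarith) (by linarith)
    simp only [hq] at hs
    have := hs.unique (hasSum_sibuya_mul_pow h0 h1 (by rw [abs_of_pos] <;> linarith))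
    rw [one_sub_rpow_one_div h0.ne' hu1.le] at this
    rwa [this] at hG
  · rintro ⟨hb1, hb2⟩
    refine ⟨invSibuya (1 / a) hb1 hb2, tsum_mul_invSibuya_le_one hb1 hb2, ℕ × ℕ → ℕ,
      inferInstance, Measure.infinitePi fun _ => (invSibuya (1 / a) hb1 hb2).toMeasure,
      inferInstance, fun n k ω => ω (n, k), isOffspringFamily_infinitePi _, fun n => ?_⟩
    have hX := isOffspringFamily_infinitePi (invSibuya (1 / a) hb1 hb2)
    have hlt1 : ∀ᶠ z in 𝓝[>] (0 : ℝ), z < 1 :=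
      nhdsWithin_le_nhds (Iio_mem_nhds one_pos)
    refine (ENNReal.toReal_eq_toReal_iff' (measure_ne_top _ _) (PMF.apply_ne_top _ _)).1
      (congrFun (eq_of_eventually_hasSum_pow
        (a := fun n : ℕ => ((Measure.infinitePi fun _ : ℕ × ℕ =>
          (invSibuya (1 / a) hb1 hb2).toMeasure) {ω | totalProgeny (fun n k ω => ω (n, k)) ω
            = (n : ℝ≥0∞)}).toReal)
        (c := fun n => (sibuya a h0 h1 n).toReal) (f := fun z => 1 - (1 - z) ^ a) ?_ ?_) n)
    · filter_upwards [hlt1, self_mem_nhdsWithin] with z hz1 (hz0 : 0 < z)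
      obtain ⟨h, hh0, hhz, hs, hG⟩ := hX.exists_hasSum_totalProgeny hz0 hz1
      simp only [invSibuya_apply, ENNReal.toReal_ofReal (invSibuyaCoeff_nonneg hb1 hb2 _)] at hG
      -- If `h = 0`, then `G(0) = h / z = 0`, contradicting the constant coefficient `1 / b = a`.
      -- Positivity then allows cancelling `h` from `h / z = F_b(h)`.
      have hpos : 0 < h := by
        refine hh0.lt_of_ne fun h00 => ?_
        subst h00
        have h2 := hG.unique (hasSum_single 0 fun n hn => by simp [hn])
        have h3 := invSibuyaCoeff_zero hb.ne'
        simp at h2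
        rw [one_div, ← h2] at h3
        simp at h3
      have h2 := hG.unique (hasSum_invSibuyaCoeff hb1 hb2 hpos.ne'
        (by rw [abs_of_pos hpos]; linarith))
      have h3 : (1 - h) ^ (1 / a) < 1 := Real.rpow_lt_one (by linarith) (by linarith) hb
      have hz : z = 1 - (1 - h) ^ (1 / a) := by
        rw [div_eq_div_iff hz0.ne' (by linarith)] at h2
        exact (mul_left_cancel₀ hpos.ne' h2).symm
      have h4 := one_sub_rpow_one_div h0.ne' (show h ≤ 1 by linarith)
      rw [← hz] at h4
      rwa [h4]
    · filter_upwards [hlt1, self_mem_nhdsWithin] with z hz1 (hz0 : 0 < z)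
      exact hasSum_sibuya_mul_pow h0 h1 (by rwa [abs_of_pos hz0])

theorem proposition1 :
    (∀ (a : ℝ) (h0 : 0 < a) (h1 : a < 1),
      (IsProgeny (sibuya a h0 h1) ↔ 1 / 2 ≤ a ∧ a < 1) ∧
      (IsProgeny (sibuya a h0 h1) ↔
        HasNonnegPowerSeries (fun u : ℝ => u / (1 - (1 - u) ^ (1 / a))))) ∧
    (∀ b : ℝ, b ≠ 0 →
      (HasNonnegPowerSeries (fun u : ℝ => u / (1 - (1 - u) ^ b)) ↔ 1 ≤ b ∧ b ≤ 2)) := by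
  refine ⟨fun a h0 h1 => ⟨?_, ?_⟩, fun b hb => hasNonnegPowerSeries_iff hb⟩
  · rw [isProgeny_sibuya_iff, le_div_iff₀ h0, div_le_iff₀ h0]
    constructor
    · rintro ⟨-, h⟩
      exact ⟨by linarith, h1⟩
    · rintro ⟨h, -⟩
      exact ⟨by linarith, by linarith⟩
  · rw [isProgeny_sibuya_iff, hasNonnegPowerSeries_iff (by positivity)]
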